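/- Let $\Omega$ be a countably infinite set, let $\mathrm{Sym}(\Omega)$ carry the topology of pointwise convergence (with $\Omega$ discrete), and let $G\le\mathrm{Sym}(\Omega)$ be a closed subgroup. For $A\subseteq\Omega$ let $G_A=\{g\in G: g(a)=a \text{ for all } a\in A\}$. Assume that 1. $G$ is oligomorphic: for every $n\in\mathbb{N}$ the diagonal action of $G$ on $\Omega^n$ has only finitely many orbits; 2. $G$ has no algebraicity: for every finite $A\subseteq\Omega$, every orbit of $G_A$ on $\Omega\setminus A$ is infinite; 3. $G$ weakly eliminates imaginaries: for every open subgroup $V\le G$ there is a finite $A\subseteq\Omega$ such that $G_A\le V$ and $[V:G_A]<\infty$. Then $G$ is dissociated, that is, the following two (equivalent) properties hold. (a) For every unitary representation $\pi\colon G\to\mathcal U(\mathcal H)$ on a complex Hilbert space (a homomorphism, continuous for the strong operator topology) and all finite $A,B\subseteq\Omega$, one has $p_Ap_B=p_{A\cap B}$, where $p_C$ denotes the orthogonal projection of $\mathcal H$ onto the subspace of $G_C$-invariant vectors. (b) For every standard probability space $(X,\mu)$, every homomorphism $\alpha\colon G\to\mathrm{Aut}(X,\mu)$ that is continuous for the weak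 topology, where $\mathrm{Aut}(X,\mu)$ is the group of measure-preserving automorphisms of $(X,\mu)$ modulo almost everywhere equality, and all finite $A,B\subseteq\Omega$, the $\sigma$-algebras $\mathcal F_A$ and $\mathcal F_B$ are independent conditionally on $\mathcal F_{A\cap B}$. Here $\mathcal F_C$ is the $\sigma$-algebra of the measurable sets $Y\subseteq X$ with $\mu(\alpha(g)Y\,\triangle\, Y)=0$ for all $g\in G_C$, and the conditional independence means that $\mathbb E[f\mid\mathcal F_A]=\mathbb E[f\mid\mathcal F_{A\cap B}]$ almost everywhere for every $\mathcal F_B$-measurable $f\in L^2(X,\mu)$. -/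

import Mathlib

open MeasureTheory Filter Topology
open scoped symmDiff

universe u v w

noncomputable section

/-- The topology of pointwise convergence on `Sym(Ω)`: the topology induced by the product
topology on `Ω → Ω`, where `Ω` is discrete. -/
instance permPointwiseTopology (Ω : Type u) : TopologicalSpace (Equiv.Perm Ω) :=
  TopologicalSpace.induced (fun σ : Equiv.Perm Ω => (σ : Ω → Ω))
    (@Pi.topologicalSpace Ω (fun _ => Ω) (fun _ => ⊥))

namespace PermGroup

variable {Ω : Type u}

/-- The pointwise stabilizer `G_A`, as a subgroup of `G`. -/
abbrev pointStab (G : Subgroup (Equiv.Perm Ω)) (A : Set Ω) : Subgroup G :=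
  fixingSubgroup G A

/-- For every `n`, the diagonal action of `G` on `Ω ^ n` has finitely many orbits. -/
def IsOligomorphic (G : Subgroup (Equiv.Perm Ω)) : Prop :=
  ∀ n : ℕ, Finite (MulAction.orbitRel.Quotient G (Fin n → Ω))

/-- For every finite `A`, all orbits of `G_A` on `Ω \ A` are infinite. -/
def NoAlgebraicity (G : Subgroup (Equiv.Perm Ω)) : Prop :=
  ∀ A : Set Ω, A.Finite → ∀ x : Ω, x ∉ A → (MulAction.orbit (pointStab G A) x).Infinite

/-- Every open subgroup `V` of `G` contains some `G_A`, `A` finite, as a subgroup of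
finite index. -/
def WeaklyEliminatesImaginaries (G : Subgroup (Equiv.Perm Ω)) : Prop :=
  ∀ V : Subgroup G, IsOpen (V : Set G) →
    ∃ A : Set Ω, A.Finite ∧ pointStab G A ≤ V ∧ (pointStab G A).IsFiniteRelIndex V

/-! ### Unitary representations -/

/-- A unitary representation of `G` on `H`: a homomorphism to the unitary group of `H` that is
continuous for the strong operator topology. -/
structure UnitaryRep (G : Subgroup (Equiv.Perm Ω)) (H : Type v) [NormedAddCommGroup H]
    [InnerProductSpace ℂ H] where
  toHom : G →* (H ≃ₗᵢ[ℂ] H)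
  continuous_apply : ∀ ξ : H, Continuous fun g : G => toHom g ξ

namespace UnitaryRep

variable {G : Subgroup (Equiv.Perm Ω)} {H : Type v} [NormedAddCommGroup H]
  [InnerProductSpace ℂ H]

/-- The subspace of the `G_A`-invariant vectors. -/
def invariants (π : UnitaryRep G H) (A : Set Ω) : Submodule ℂ H where
  carrier := {ξ | ∀ g ∈ pointStab G A, π.toHom g ξ = ξ}
  add_mem' := by
    intro x y hx hy g hg
    rw [map_add, hx g hg, hy g hg]
  zero_mem' := by
    intro g _
    exact map_zero _
  smul_mem' := by
    intro c x hx g hg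
    rw [map_smul, hx g hg]

theorem isClosed_invariants (π : UnitaryRep G H) (A : Set Ω) :
    IsClosed (π.invariants A : Set H) := by
  have h : (π.invariants A : Set H) = ⋂ g ∈ pointStab G A, {ξ | π.toHom g ξ = ξ} := by
    ext ξ
    simp [invariants]
  rw [h]
  exact isClosed_biInter fun g _ => isClosed_eq (π.toHom g).continuous continuous_id

instance [CompleteSpace H] (π : UnitaryRep G H) (A : Set Ω) :
    (π.invariants A).HasOrthogonalProjection :=
  haveI : CompleteSpace (π.invariants A) := (π.isClosed_invariants A).completeSpace_coe
  inferInstance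

/-- `p_A p_B = p_{A ∩ B}` for all finite `A`, `B`, where `p_A` is the orthogonal projection
onto the `G_A`-invariant vectors. -/
def IsDissociated [CompleteSpace H] (π : UnitaryRep G H) : Prop :=
  ∀ A B : Set Ω, A.Finite → B.Finite →
    (π.invariants A).starProjection ∘L (π.invariants B).starProjection =
      (π.invariants (A ∩ B)).starProjection

end UnitaryRep

/-! ### Boolean probability-measure-preserving actions -/

/-- A Boolean p.m.p. action of `G` on `(X, μ)`: a homomorphism from `G` to the group
`Aut(X, μ)` of measure-preserving automorphisms modulo almost everywhere equality, continuous
for the weak topology. It is given by a choice of representatives, so that the homomorphism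
identities hold almost everywhere. The weak topology is the one in which `T` is close to `S`
when `μ (T Y ∆ S Y)` is small for finitely many given measurable sets `Y`. -/
structure BooleanAction (G : Subgroup (Equiv.Perm Ω)) {X : Type w} [MeasurableSpace X]
    (μ : Measure X) where
  toEquiv : G → X ≃ᵐ X
  measurePreserving : ∀ g, MeasurePreserving (toEquiv g) μ μ
  map_one : ∀ᵐ x ∂μ, toEquiv 1 x = x
  map_mul : ∀ g h, ∀ᵐ x ∂μ, toEquiv (g * h) x = toEquiv g (toEquiv h x)
  weakly_continuous : ∀ Y : Set X, MeasurableSet Y → ∀ g₀ : G,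
    Tendsto (fun g : G => μ ((toEquiv g '' Y) ∆ (toEquiv g₀ '' Y))) (𝓝 g₀) (𝓝 0)

namespace BooleanAction

variable {G : Subgroup (Equiv.Perm Ω)} {X : Type w} [MeasurableSpace X] {μ : Measure X}

/-- The σ-algebra of the measurable sets `Y` with `μ (g Y ∆ Y) = 0` for all `g ∈ G_A`. -/
@[reducible] def invariantSigma (α : BooleanAction G μ) (A : Set Ω) : MeasurableSpace X where
  MeasurableSet' Y := MeasurableSet Y ∧
    ∀ g ∈ pointStab G A, μ ((α.toEquiv g '' Y) ∆ Y) = 0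
  measurableSet_empty := by simp
  measurableSet_compl := by
    rintro Y ⟨hY, h⟩
    refine ⟨hY.compl, fun g hg => ?_⟩
    rw [Set.image_compl_eq (α.toEquiv g).bijective, measure_symmDiff_eq_zero_iff]
    exact (measure_symmDiff_eq_zero_iff.1 (h g hg)).compl
  measurableSet_iUnion := by
    intro f hf
    refine ⟨MeasurableSet.iUnion fun i => (hf i).1, fun g hg => ?_⟩
    rw [Set.image_iUnion, measure_symmDiff_eq_zero_iff]
    exact Filter.EventuallyEq.countable_iUnion fun i =>
      measure_symmDiff_eq_zero_iff.1 ((hf i).2 g hg)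

theorem invariantSigma_le (α : BooleanAction G μ) (A : Set Ω) :
    α.invariantSigma A ≤ ‹MeasurableSpace X› :=
  fun _ h => h.1

end BooleanAction

/-- `F₁` and `F₃` are independent conditionally on `F₂` (where `F₂ ≤ F₁ ⊓ F₃`):
`E[f | F₁] = E[f | F₂]` for every square-integrable `F₃`-measurable `f : X → ℂ`. -/
def CondIndependent {X : Type w} [MeasurableSpace X] (μ : Measure X)
    (F₁ F₃ F₂ : MeasurableSpace X) : Prop :=
  ∀ f : X → ℂ, Measurable[F₃] f → MemLp f 2 μ → μ[f|F₁] =ᵐ[μ] μ[f|F₂]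

/-- For all finite `A`, `B`, the σ-algebras of `G_A`- and `G_B`-invariant sets are independent
conditionally on that of the `G_{A ∩ B}`-invariant sets. -/
def BooleanAction.IsDissociated {G : Subgroup (Equiv.Perm Ω)} {X : Type w} [MeasurableSpace X]
    {μ : Measure X} (α : BooleanAction G μ) : Prop :=
  ∀ A B : Set Ω, A.Finite → B.Finite →
    CondIndependent μ (α.invariantSigma A) (α.invariantSigma B) (α.invariantSigma (A ∩ B))

/-- `G` is dissociated: all its unitary representations on complex Hilbert spaces and all its
Boolean p.m.p. actions on standard probability spaces are dissociated. -/
def IsDissociated (G : Subgroup (Equiv.Perm Ω)) : Prop :=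
  (∀ (H : Type v) [NormedAddCommGroup H] [InnerProductSpace ℂ H] [CompleteSpace H]
      (π : UnitaryRep G H), π.IsDissociated) ∧
  (∀ (X : Type w) [MeasurableSpace X] [StandardBorelSpace X] (μ : Measure X)
      [IsProbabilityMeasure μ] (α : BooleanAction G μ), α.IsDissociated)

end PermGroup

end

/-! Both properties reduce to orthogonality: a `G_B`-invariant vector `ξ` orthogonal to the `G_{A ∩
B}`-invariant vectors is orthogonal to the `G_A`-invariant ones (`inner_eq_zero_of_invariant`). For
(b) this is applied to the Koopman representation on `L²`, where conditional expectation is an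
orthogonal projection.

By no algebraicity and Neumann's lemma there are `g n ∈ G_A` such that the sets `g n • B` meet
pairwise only inside `A ∩ B`. Let `w` be a weak limit of the vectors `g n ξ`; it has the same inner
products as `ξ` with `G_A`-invariant vectors. By oligomorphicity the coefficient `k ↦ ⟪k ξ, ξ⟫` has
finite range, and this rigidity makes `w` invariant under the stabilizer of finitely many `g n • B`,
with `n` as large as desired (`exists_finite_fixing_weak_limit`). Two disjoint blocks of indices
give finite sets meeting inside `A ∩ B`, and weak elimination of imaginaries shows that their
stabilizers together generate a group containing `G_{A ∩ B}` (`pointStab_inter_le_sup`). So `w` is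
`G_{A ∩ B}`-invariant, whence `⟪w, w⟫ = ⟪ξ, w⟫ = 0` and `⟪ξ, η⟫ = ⟪w, η⟫ = 0` for every
`G_A`-invariant `η`. -/

open scoped Pointwise

/-! ### Group actions -/

/-- P. M. Neumann's separation lemma: a finite set of points with infinite orbits can be moved
off any given finite set. -/
theorem MulAction.exists_smul_notMem_of_infinite_orbits {K X : Type*} [Group K] [MulAction K X]
    {s t : Set X} (hs : s.Finite) (ht : t.Finite) (h : ∀ c ∈ s, (MulAction.orbit K c).Infinite) :
    ∃ g : K, ∀ c ∈ s, g • c ∉ t := by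
  classical
  by_contra! hcon
  let I : Finset (X × X) := (hs.toFinset ×ˢ ht.toFinset).filter fun p => p.2 ∈ MulAction.orbit K p.1
  have hex : ∀ p : X × X, ∃ g : K, p.2 ∈ MulAction.orbit K p.1 → g • p.1 = p.2 := fun p => by
    by_cases hp : p.2 ∈ MulAction.orbit K p.1
    · obtain ⟨g, hg⟩ := hp
      exact ⟨g, fun _ => hg⟩
    · exact ⟨1, fun h => (hp h).elim⟩
  choose γ hγ using hex
  -- If every `g` sends some point of `s` into `t`, finitely many cosets of point stabilizers cover
  -- `K`. By B. H. Neumann's lemma one of these stabilizers has finite index, so its orbit is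
  -- finite.
  have hcov : ⋃ p ∈ I, γ p • (MulAction.stabilizer K p.1 : Set K) = Set.univ := by
    refine Set.eq_univ_of_forall fun g => ?_
    obtain ⟨c, hc, hgc⟩ := hcon g
    have hmem : g • c ∈ MulAction.orbit K c := MulAction.mem_orbit _ _
    refine Set.mem_biUnion (x := (c, g • c)) ?_ ?_
    · simp [I, hc, hgc]
    · rw [mem_leftCoset_iff]
      simp only [SetLike.mem_coe, MulAction.mem_stabilizer_iff, mul_smul]
      rw [inv_smul_eq_iff]
      exact (hγ (c, g • c) hmem).symm
  obtain ⟨p, hp, hfin⟩ := Subgroup.exists_finiteIndex_of_leftCoset_cover hcov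
  have hps : p.1 ∈ s := by
    simp only [I, Finset.mem_filter, Finset.mem_product, Set.Finite.mem_toFinset] at hp
    exact hp.1.1
  refine h p.1 hps (Set.finite_of_ncard_ne_zero ?_)
  rw [← MulAction.index_stabilizer]
  exact hfin.index_ne_zero

namespace PermGroup

variable {Ω : Type u} {G : Subgroup (Equiv.Perm Ω)}

theorem isOpen_of_pointStab_le {A : Set Ω} (hA : A.Finite) {V : Subgroup G}
    (h : pointStab G A ≤ V) : IsOpen (V : Set G) := by
  let _ : TopologicalSpace Ω := ⊥
  have _ : DiscreteTopology Ω := ⟨rfl⟩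
  have hev : ∀ a : Ω, Continuous fun k : G => (k : Equiv.Perm Ω) a := fun a =>
    (continuous_apply a).comp (continuous_induced_dom.comp continuous_subtype_val)
  rw [isOpen_iff_mem_nhds]
  intro g hg
  have hU : IsOpen (⋂ a ∈ A, (fun k : G => (k : Equiv.Perm Ω) a) ⁻¹' {(g : Equiv.Perm Ω) a}) :=
    hA.isOpen_biInter fun a _ => (isOpen_discrete _).preimage (hev a)
  refine Filter.mem_of_superset (hU.mem_nhds (by simp)) fun k hk => ?_
  simp only [Set.mem_iInter, Set.mem_preimage, Set.mem_singleton_iff] at hk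
  have hmem : g⁻¹ * k ∈ pointStab G A := by
    rw [mem_fixingSubgroup_iff]
    intro a ha
    rw [mul_smul, inv_smul_eq_iff]
    exact hk a ha
  simpa using V.mul_mem hg (h hmem)

/-- For `c ∈ C \ A`, the group `G_A ∩ G_C` would have finite index in `G_A` and fix `c`, making the
`G_A`-orbit of `c` finite. -/
theorem NoAlgebraicity.subset_of_isFiniteRelIndex (hna : NoAlgebraicity G) {A C : Set Ω}
    (hA : A.Finite) {V : Subgroup G} (hAV : pointStab G A ≤ V)
    (hCV : (pointStab G C).IsFiniteRelIndex V) : C ⊆ A := by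
  intro c hc
  by_contra hcA
  refine hna A hA c hcA (Set.finite_of_ncard_ne_zero ?_)
  rw [← MulAction.index_stabilizer]
  have h1 : (pointStab G C).relIndex (pointStab G A) ≠ 0 := fun h0 =>
    hCV.relIndex_ne_zero (Subgroup.relIndex_eq_zero_of_le_right hAV h0)
  have h2 : ((pointStab G C).subgroupOf (pointStab G A)).FiniteIndex := ⟨h1⟩
  have h3 : (pointStab G C).subgroupOf (pointStab G A) ≤
      MulAction.stabilizer (pointStab G A) c := fun g hg =>
    (mem_fixingSubgroup_iff G).1 (Subgroup.mem_subgroupOf.1 hg) c hc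
  exact (Subgroup.finiteIndex_of_le h3).index_ne_zero

/-- The join is open, so it contains some `G_C` with finite index; the preceding lemma, applied to
`A` and to `B`, forces `C ⊆ A ∩ B`. -/
theorem pointStab_inter_le_sup (hna : NoAlgebraicity G) (hwei : WeaklyEliminatesImaginaries G)
    {A B : Set Ω} (hA : A.Finite) (hB : B.Finite) :
    pointStab G (A ∩ B) ≤ pointStab G A ⊔ pointStab G B := by
  obtain ⟨C, -, hCle, hCfin⟩ :=
    hwei (pointStab G A ⊔ pointStab G B) (isOpen_of_pointStab_le hA le_sup_left)
  have hCA := hna.subset_of_isFiniteRelIndex hA le_sup_left hCfin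
  have hCB := hna.subset_of_isFiniteRelIndex hB le_sup_right hCfin
  exact (fixingSubgroup_antitone G Ω (Set.subset_inter hCA hCB)).trans hCle

/-- `G_A` fixes `A ∩ B` pointwise and has infinite orbits on `B \ A`, so Neumann's lemma moves `B \
A` off all the earlier translates of `B`. -/
theorem NoAlgebraicity.exists_seq_separated (hna : NoAlgebraicity G) {A B : Set Ω}
    (hA : A.Finite) (hB : B.Finite) :
    ∃ g : ℕ → G, (∀ n, g n ∈ pointStab G A) ∧
      ∀ m n, m < n → (g m • B) ∩ (g n • B) ⊆ A ∩ B := by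
  have key : ∀ s : Finset G, (∀ x ∈ s, x ∈ pointStab G A) →
      ∃ y, y ∈ pointStab G A ∧ ∀ x ∈ s, ∀ b ∈ B \ A, y • b ∉ x • B := by
    intro s _
    obtain ⟨y, hy⟩ := MulAction.exists_smul_notMem_of_infinite_orbits (K := pointStab G A)
      (hB.sdiff (t := A)) (t := ⋃ x ∈ s, x • B) (s.finite_toSet.biUnion fun x _ => hB.smul_set)
      fun c hc => hna A hA c hc.2
    refine ⟨y, y.2, fun x hx b hb hmem => hy b hb ?_⟩
    exact Set.mem_biUnion (Finset.mem_coe.2 hx) hmem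
  obtain ⟨g, hg, hsep⟩ := exists_seq_of_forall_finset_exists _ _ key
  refine ⟨g, hg, fun m n hmn x hx => ?_⟩
  obtain ⟨hxm, b, hb, rfl⟩ := hx
  by_cases hbA : b ∈ A
  · have hfix : g n • b = b := (mem_fixingSubgroup_iff G).1 (hg n) b hbA
    simpa [hfix] using ⟨hbA, hb⟩
  · exact (hsep m n hmn b ⟨hb, hbA⟩ hxm).elim

end PermGroup

/-! ### Weak limits in orbits of isometric representations -/

theorem Set.Finite.exists_pos_eq_of_dist_lt {X : Type*} [MetricSpace X] {s : Set X}
    (hs : s.Finite) : ∃ ε > 0, ∀ a ∈ s, ∀ b ∈ s, dist a b < ε → a = b := by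
  have hpos : ∀ p ∈ s ×ˢ s, ∀ᶠ ε : ℝ in 𝓝[>] 0, dist p.1 p.2 < ε → p.1 = p.2 := by
    intro p _
    obtain h | h := eq_or_ne p.1 p.2
    · exact Eventually.of_forall fun _ _ => h
    · filter_upwards [Ioo_mem_nhdsGT (dist_pos.2 h)] with ε hε hlt
      exact absurd hlt hε.2.not_gt
  obtain ⟨ε, hε, h0⟩ := (((hs.prod hs).eventually_all.2 hpos).and self_mem_nhdsWithin).exists
  exact ⟨ε, h0, fun a ha b hb => hε (a, b) ⟨ha, hb⟩⟩

section WeakLimit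

variable {H : Type v} [NormedAddCommGroup H] [InnerProductSpace ℂ H]

/-- Banach–Alaoglu, transported through the Riesz isomorphism. -/
theorem exists_weak_limit [CompleteSpace H] {ι : Type*} (F : Ultrafilter ι) (x : ι → H) (r : ℝ)
    (hx : ∀ i, ‖x i‖ ≤ r) :
    ∃ w : H, ∀ y, Tendsto (fun i => inner ℂ (x i) y) F (𝓝 (inner ℂ w y)) := by
  let φ : ι → WeakDual ℂ H := fun i =>
    StrongDual.toWeakDual (InnerProductSpace.toDual ℂ H (x i))
  have hφ : ∀ i, φ i ∈ WeakDual.toStrongDual ⁻¹' Metric.closedBall (0 : StrongDual ℂ H) r := by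
    intro i
    simpa [φ] using hx i
  obtain ⟨ψ, -, hψ⟩ := (WeakDual.isCompact_closedBall (𝕜 := ℂ) (E := H) 0 r).ultrafilter_le_nhds
    (F.map φ) (by
      rw [le_principal_iff]
      exact Filter.mem_map.2 (Filter.univ_mem' hφ))
  refine ⟨(InnerProductSpace.toDual ℂ H).symm (WeakDual.toStrongDual ψ), fun y => ?_⟩
  have h1 : Tendsto φ F (𝓝 ψ) := hψ
  have h2 := ((WeakDual.eval_continuous y).tendsto ψ).comp h1
  rw [InnerProductSpace.toDual_symm_apply]
  exact h2

theorem mem_closure_span_of_weak_limit [CompleteSpace H] {ι : Type*} {F : Ultrafilter ι}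
    {x : ι → H} {w : H} (hw : ∀ y, Tendsto (fun i => inner ℂ (x i) y) F (𝓝 (inner ℂ w y)))
    {s : Set ι} (hs : s ∈ F) : w ∈ (Submodule.span ℂ (x '' s)).topologicalClosure := by
  rw [← Submodule.orthogonal_orthogonal_eq_closure, Submodule.mem_orthogonal']
  intro y hy
  refine tendsto_nhds_unique (hw y) (tendsto_const_nhds.congr' ?_)
  filter_upwards [hs] with i hi
  exact ((Submodule.mem_orthogonal _ _).1 hy _ (Submodule.subset_span ⟨i, hi, rfl⟩)).symm

theorem isometry_mul_apply (S T : H →ₗᵢ[ℂ] H) (x : H) : (S * T) x = S (T x) :=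
  rfl

variable {K : Type*} [Group K] (ρ : K →* (H →ₗᵢ[ℂ] H))

theorem inner_rep_eq_inner_inv (k : K) (x y : H) :
    inner ℂ (ρ k x) y = inner ℂ x (ρ k⁻¹ y) := by
  rw [← (ρ k).inner_map_map x, ← isometry_mul_apply, ← map_mul]
  simp

/-- The stabilizer of a vector in an isometric representation. -/
def vectorStabilizer (w : H) : Subgroup K where
  carrier := {k | ρ k w = w}
  one_mem' := by simp
  mul_mem' {a b} ha hb := by
    simp only [Set.mem_ofPred_eq] at ha hb ⊢
    rw [map_mul, isometry_mul_apply, hb, ha]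
  inv_mem' {a} ha := by
    simp only [Set.mem_ofPred_eq] at ha ⊢
    conv_lhs => rw [← ha]
    rw [← isometry_mul_apply, ← map_mul]
    simp

/-- If a matrix coefficient of `ξ` takes finitely many values, then any weak limit of vectors in
the orbit of `ξ` is fixed by everything that fixes suitable finitely many of these vectors. -/
theorem exists_finite_fixing_weak_limit [CompleteSpace H] {ι : Type*} {F : Ultrafilter ι} {ξ : H}
    (hfin : (Set.range fun k => inner ℂ (ρ k ξ) ξ).Finite) {g : ι → K} {w : H}
    (hw : ∀ y, Tendsto (fun i => inner ℂ (ρ (g i) ξ) y) F (𝓝 (inner ℂ w y)))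
    {s : Set ι} (hs : s ∈ F) :
    ∃ t : Finset ι, ↑t ⊆ s ∧ ∀ k, (∀ i ∈ t, ρ k (ρ (g i) ξ) = ρ (g i) ξ) → ρ k w = w := by
  classical
  have hcl := mem_closure_span_of_weak_limit hw hs
  set R := Set.range fun k => inner ℂ (ρ k ξ) ξ
  have hval : ∀ k, inner ℂ w (ρ k ξ) ∈ R := by
    intro k
    refine hfin.isClosed.mem_of_tendsto (hw (ρ k ξ)) (Eventually.of_forall fun i => ?_)
    refine ⟨k⁻¹ * g i, ?_⟩
    simp [map_mul, inner_rep_eq_inner_inv]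
  obtain ⟨ε, hε, hgap⟩ := hfin.exists_pos_eq_of_dist_lt
  -- Both `w` and `ρ k w` will lie this close to `v`, so their inner products with a vector of norm
  -- `‖ξ‖` differ by less than the gap `ε` of `R`.
  have hδ : 0 < ε / (2 * (‖ξ‖ + 1)) := by positivity
  obtain ⟨v, hv, hvw⟩ := Metric.mem_closure_iff.1 hcl _ hδ
  obtain ⟨t, hts, c, rfl⟩ := (Submodule.mem_span_image_iff_exists_fun ℂ).1 hv
  refine ⟨t, hts, fun k hk => ?_⟩
  set v := ∑ i : t, c i • ρ (g i) ξ with hvdef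
  have hkv : ρ k v = v := by
    simp only [hvdef, map_sum, map_smul]
    exact Finset.sum_congr rfl fun i _ => by rw [hk i i.2]
  have hwv : ‖w - v‖ < ε / (2 * (‖ξ‖ + 1)) := by rwa [← dist_eq_norm]
  have hkwv : ‖ρ k w - v‖ < ε / (2 * (‖ξ‖ + 1)) := by
    rwa [← hkv, ← map_sub, (ρ k).norm_map]
  -- The inner products of `w` and `ρ k w` with `ρ h ξ` both lie in the finite set `R` and are
  -- closer than its gap, hence equal.
  have horth : ∀ h, inner ℂ (ρ h ξ) (ρ k w - w) = 0 := by
    intro h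
    have h1 : inner ℂ (ρ k w) (ρ h ξ) = inner ℂ w (ρ h ξ) := by
      refine hgap _ ?_ _ (hval h) ?_
      · rw [inner_rep_eq_inner_inv, ← isometry_mul_apply, ← map_mul]
        exact hval _
      · rw [dist_eq_norm, ← inner_sub_left]
        have h2 : ‖ρ k w - w‖ < ε / (‖ξ‖ + 1) := calc
          ‖ρ k w - w‖ = ‖(ρ k w - v) - (w - v)‖ := by congr 1; abel
          _ ≤ ‖ρ k w - v‖ + ‖w - v‖ := norm_sub_le _ _
          _ < ε / (2 * (‖ξ‖ + 1)) + ε / (2 * (‖ξ‖ + 1)) := add_lt_add hkwv hwv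
          _ = ε / (‖ξ‖ + 1) := by field_simp; norm_num
        calc ‖inner ℂ (ρ k w - w) (ρ h ξ)‖ ≤ ‖ρ k w - w‖ * ‖ρ h ξ‖ := norm_inner_le_norm _ _
          _ ≤ ‖ρ k w - w‖ * (‖ξ‖ + 1) := by
            rw [(ρ h).norm_map]
            gcongr
            linarith
          _ < ε := (lt_div_iff₀ (by positivity)).1 h2
    rw [← inner_conj_symm, inner_sub_left, h1, sub_self, map_zero]
  -- Both `w` and `ρ k w` are weak limits of vectors in the orbit of `ξ`, so `ρ k w - w` is
  -- orthogonal to each of them, and thus to itself.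
  have hlim : ∀ y, (∀ i, inner ℂ (ρ (g i) ξ) y = 0) → inner ℂ w y = 0 := fun y hy =>
    tendsto_nhds_unique (hw y) (tendsto_const_nhds.congr fun i => (hy i).symm)
  have hw0 : inner ℂ w (ρ k w - w) = 0 := hlim _ fun i => horth _
  have hkw0 : inner ℂ (ρ k w) (ρ k w - w) = 0 := by
    rw [inner_rep_eq_inner_inv]
    refine hlim _ fun i => ?_
    rw [← inner_rep_eq_inner_inv, ← isometry_mul_apply, ← map_mul]
    exact horth _
  rw [← sub_eq_zero, ← inner_self_eq_zero (𝕜 := ℂ), inner_sub_left, hw0, hkw0, sub_zero]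

end WeakLimit

/-! ### Orthogonality of invariant vectors -/

namespace PermGroup

variable {Ω : Type u} {G : Subgroup (Equiv.Perm Ω)} {H : Type v} [NormedAddCommGroup H]
  [InnerProductSpace ℂ H]

/-- With `b` an enumeration of `B`, the coefficient at `k` depends only on the orbit of the tuple
`(b, k • b)`: if `s` carries `(b, k' • b)` to `(b, k • b)`, then `s` and `k⁻¹ s k'` both lie in
`G_B`. -/
theorem IsOligomorphic.finite_range_inner (hol : IsOligomorphic G) (ρ : G →* (H →ₗᵢ[ℂ] H))
    {B : Set Ω} (hB : B.Finite) {ξ : H} (hξ : ∀ g ∈ pointStab G B, ρ g ξ = ξ) :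
    (Set.range fun k => inner ℂ (ρ k ξ) ξ).Finite := by
  obtain ⟨n, b, -, hb⟩ := hB.fin_param
  have := hol (n + n)
  let q : G → MulAction.orbitRel.Quotient G (Fin (n + n) → Ω) := fun k =>
    Quotient.mk'' (Fin.append b (k • b))
  have hstab : ∀ s : G, (∀ i, s • b i = b i) → s ∈ pointStab G B := by
    intro s hs
    rw [mem_fixingSubgroup_iff, ← hb]
    rintro _ ⟨i, rfl⟩
    exact hs i
  have hfac : Function.FactorsThrough (fun k => inner ℂ (ρ k ξ) ξ) q := by
    intro k k' hkk'
    obtain ⟨s, hs⟩ := MulAction.orbitRel_apply.1 (Quotient.eq''.1 hkk')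
    have hs1 : ∀ i, s • b i = b i := fun i => by
      simpa using congrFun hs (Fin.castAdd n i)
    have hs2 : ∀ i, s • k' • b i = k • b i := fun i => by
      have h : (s • Fin.append b (k' • b)) (Fin.natAdd n i) = _ := congrFun hs (Fin.natAdd n i)
      rwa [Pi.smul_apply, Fin.append_right, Fin.append_right] at h
    have hsB := hstab s hs1
    have htB : k⁻¹ * (s * k') ∈ pointStab G B := hstab _ fun i => by
      rw [mul_smul, mul_smul, hs2, inv_smul_smul]
    have hk : ρ k ξ = ρ s (ρ k' ξ) := by
      conv_lhs => rw [← hξ _ htB]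
      simp only [← isometry_mul_apply, ← map_mul]
      congr 2
      group
    change inner ℂ (ρ k ξ) ξ = inner ℂ (ρ k' ξ) ξ
    rw [hk, inner_rep_eq_inner_inv, hξ _ (inv_mem hsB)]
  refine (Set.finite_range (Function.extend q (fun k => inner ℂ (ρ k ξ) ξ) 0)).subset ?_
  rintro _ ⟨k, rfl⟩
  exact ⟨q k, hfac.extend_apply _ _⟩

/-- A `G_B`-invariant vector orthogonal to all `G_{A ∩ B}`-invariant vectors is orthogonal to all
`G_A`-invariant vectors. -/
theorem inner_eq_zero_of_invariant [CompleteSpace H] (hol : IsOligomorphic G)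
    (hna : NoAlgebraicity G) (hwei : WeaklyEliminatesImaginaries G) (ρ : G →* (H →ₗᵢ[ℂ] H))
    {A B : Set Ω} (hA : A.Finite) (hB : B.Finite) {ξ η : H}
    (hξ : ∀ g ∈ pointStab G B, ρ g ξ = ξ)
    (hξ' : ∀ ζ, (∀ g ∈ pointStab G (A ∩ B), ρ g ζ = ζ) → inner ℂ ξ ζ = 0)
    (hη : ∀ g ∈ pointStab G A, ρ g η = η) : inner ℂ ξ η = 0 := by
  obtain ⟨g, hgA, hsep⟩ := hna.exists_seq_separated hA hB
  obtain ⟨w, hw⟩ := exists_weak_limit (hyperfilter ℕ) (fun n => ρ (g n) ξ) ‖ξ‖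
    fun n => ((ρ (g n)).norm_map ξ).le
  have hfin := hol.finite_range_inner ρ hB hξ
  have hle : ∀ t : Finset ℕ, (∀ k, (∀ i ∈ t, ρ k (ρ (g i) ξ) = ρ (g i) ξ) → ρ k w = w) →
      pointStab G (⋃ i ∈ t, g i • B) ≤ vectorStabilizer ρ w := by
    intro t ht k hk
    refine ht k fun i hi => ?_
    have hmem : (g i)⁻¹ * (k * g i) ∈ pointStab G B := by
      rw [mem_fixingSubgroup_iff]
      intro b hb
      rw [mul_smul, inv_smul_eq_iff, mul_smul]
      exact (mem_fixingSubgroup_iff G).1 hk _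
        (Set.mem_biUnion (Finset.mem_coe.2 hi) (Set.smul_mem_smul_set hb))
    conv_rhs => rw [← hξ _ hmem]
    simp only [← isometry_mul_apply, ← map_mul]
    congr 2
    group
  -- Choosing `t₂` entirely beyond `t₁` makes the index blocks disjoint, so only intersections of
  -- distinct translates occur.
  obtain ⟨t₁, -, ht₁⟩ := exists_finite_fixing_weak_limit ρ hfin hw Filter.univ_mem
  obtain ⟨N, hN⟩ := t₁.finite_toSet.bddAbove
  have htail : Set.Ioi N ∈ hyperfilter ℕ :=
    Nat.hyperfilter_le_atTop (Ioi_mem_atTop N)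
  obtain ⟨t₂, ht₂N, ht₂⟩ := exists_finite_fixing_weak_limit ρ hfin hw htail
  have hsub : (⋃ i ∈ t₁, g i • B) ∩ (⋃ j ∈ t₂, g j • B) ⊆ A ∩ B := by
    rintro x ⟨hx₁, hx₂⟩
    simp only [Set.mem_iUnion] at hx₁ hx₂
    obtain ⟨i, hi, hxi⟩ := hx₁
    obtain ⟨j, hj, hxj⟩ := hx₂
    exact hsep i j ((hN hi).trans_lt (ht₂N hj)) ⟨hxi, hxj⟩
  have hunion : ∀ t : Finset ℕ, (⋃ i ∈ t, g i • B).Finite := fun t =>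
    t.finite_toSet.biUnion fun i _ => hB.smul_set
  have hwD : ∀ k ∈ pointStab G (A ∩ B), ρ k w = w := fun k hk =>
    (pointStab_inter_le_sup hna hwei (hunion t₁) (hunion t₂)).trans
      (sup_le (hle t₁ ht₁) (hle t₂ ht₂)) (fixingSubgroup_antitone G Ω hsub hk)
  have hlim : ∀ ζ, (∀ k ∈ pointStab G A, ρ k ζ = ζ) → inner ℂ w ζ = inner ℂ ξ ζ := by
    intro ζ hζ
    refine tendsto_nhds_unique (hw ζ) (tendsto_const_nhds.congr fun n => ?_)
    rw [inner_rep_eq_inner_inv, hζ _ (inv_mem (hgA n))]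
  -- As `G_A ≤ G_{A ∩ B}`, the vector `w` is itself `G_A`-invariant and may be tested against
  -- itself.
  have hw0 : w = 0 := by
    rw [← inner_self_eq_zero (𝕜 := ℂ), hlim w fun k hk => hwD k
      (fixingSubgroup_antitone G Ω Set.inter_subset_left hk)]
    exact hξ' w hwD
  rw [← hlim η hη, hw0, inner_zero_left]

/-! ### Unitary representations -/

theorem starProjection_comp_eq_of_orthogonal {K L M : Submodule ℂ H} [K.HasOrthogonalProjection]
    [L.HasOrthogonalProjection] [M.HasOrthogonalProjection] (hMK : M ≤ K) (hML : M ≤ L)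
    (h : ∀ ξ ∈ L, (∀ ζ ∈ M, inner ℂ ξ ζ = 0) → ∀ η ∈ K, inner ℂ ξ η = 0) :
    K.starProjection ∘L L.starProjection = M.starProjection := by
  ext x
  rw [ContinuousLinearMap.comp_apply]
  refine Submodule.eq_starProjection_of_mem_orthogonal (hMK (M.starProjection_apply_mem x)) ?_
  have hx : ∀ ζ ∈ M, inner ℂ (L.starProjection x - M.starProjection x) ζ = 0 := by
    intro ζ hζ
    rw [← sub_sub_sub_cancel_left _ _ x, inner_sub_left,
      M.starProjection_inner_eq_zero x ζ hζ, L.starProjection_inner_eq_zero x ζ (hML hζ), sub_zero]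
  rw [Submodule.mem_orthogonal']
  exact h _ (L.sub_mem (L.starProjection_apply_mem x) (hML (M.starProjection_apply_mem x))) hx

theorem UnitaryRep.isDissociated [CompleteSpace H] (hol : IsOligomorphic G)
    (hna : NoAlgebraicity G) (hwei : WeaklyEliminatesImaginaries G) (π : UnitaryRep G H) :
    π.IsDissociated := by
  intro A B hA hB
  let ρ : G →* (H →ₗᵢ[ℂ] H) :=
    { toFun g := (π.toHom g).toLinearIsometry
      map_one' := by rw [map_one]; rfl
      map_mul' g h := by rw [map_mul]; rfl }
  refine starProjection_comp_eq_of_orthogonal ?_ ?_ ?_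
  · exact fun ξ hξ g hg => hξ g (fixingSubgroup_antitone G Ω Set.inter_subset_left hg)
  · exact fun ξ hξ g hg => hξ g (fixingSubgroup_antitone G Ω Set.inter_subset_right hg)
  · exact fun ξ hξ hξ' η hη => inner_eq_zero_of_invariant hol hna hwei ρ hA hB hξ hξ' hη

/-! ### Boolean actions -/

namespace BooleanAction

variable {X : Type w} [MeasurableSpace X] {μ : Measure X}

theorem measurableSet_invariantSigma_iff (α : BooleanAction G μ) (A : Set Ω) {Y : Set X} :
    MeasurableSet[α.invariantSigma A] Y ↔
      MeasurableSet Y ∧ ∀ g ∈ pointStab G A, α.toEquiv g ⁻¹' Y =ᵐ[μ] Y := by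
  refine and_congr_right fun _ => forall₂_congr fun g _ => ?_
  rw [measure_symmDiff_eq_zero_iff]
  have hq := (α.measurePreserving g).quasiMeasurePreserving
  have hq' := ((α.measurePreserving g).symm (α.toEquiv g)).quasiMeasurePreserving
  constructor
  · intro h
    have := hq.preimage_ae_eq h
    rw [Set.preimage_image_eq _ (α.toEquiv g).injective] at this
    exact this.symm
  · intro h
    have := hq'.preimage_ae_eq h
    rw [← Set.preimage_comp, (α.toEquiv g).self_comp_symm, Set.preimage_id] at this
    rw [(α.toEquiv g).image_eq_preimage_symm]
    exact this.symm

/-- The Koopman representation of a Boolean action. -/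
noncomputable def koopman (α : BooleanAction G μ) : G →* (Lp ℂ 2 μ →ₗᵢ[ℂ] Lp ℂ 2 μ) where
  -- Precomposition reverses products; the inverse restores a homomorphism.
  toFun g := Lp.compMeasurePreservingₗᵢ ℂ (α.toEquiv g⁻¹) (α.measurePreserving g⁻¹)
  map_one' := by
    ext1 f
    refine Lp.ext ?_
    filter_upwards [Lp.coeFn_compMeasurePreserving f (α.measurePreserving 1⁻¹), α.map_one]
      with x hx h1
    refine hx.trans ?_
    simp only [Function.comp_apply, inv_one, h1, LinearIsometry.coe_one, id_eq]
  map_mul' g h := by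
    ext1 f
    refine Lp.ext ?_
    have hh := Lp.coeFn_compMeasurePreserving f (α.measurePreserving h⁻¹)
    filter_upwards [Lp.coeFn_compMeasurePreserving f (α.measurePreserving (g * h)⁻¹),
      α.map_mul h⁻¹ g⁻¹,
      Lp.coeFn_compMeasurePreserving (Lp.compMeasurePreserving _ (α.measurePreserving h⁻¹) f)
        (α.measurePreserving g⁻¹),
      (α.measurePreserving g⁻¹).quasiMeasurePreserving.ae hh] with x h1 h2 h3 h4
    refine h1.trans (Eq.trans ?_ (h3.trans h4).symm)
    simp only [Function.comp_apply, mul_inv_rev, h2]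

theorem koopman_eq_self_iff (α : BooleanAction G μ) (g : G) (f : Lp ℂ 2 μ) :
    α.koopman g f = f ↔ f ∘ α.toEquiv g⁻¹ =ᵐ[μ] f := by
  have h := Lp.coeFn_compMeasurePreserving f (α.measurePreserving g⁻¹)
  rw [Lp.ext_iff]
  exact ⟨fun h' => h.symm.trans h', fun h' => h.trans h'⟩

/-- Identifies the range of the conditional expectation with the invariant vectors of the Koopman
representation. -/
theorem mem_lpMeas_iff_koopman (α : BooleanAction G μ) (A : Set Ω) (f : Lp ℂ 2 μ) :
    f ∈ lpMeas ℂ ℂ (α.invariantSigma A) 2 μ ↔ ∀ g ∈ pointStab G A, α.koopman g f = f := by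
  simp only [koopman_eq_self_iff, mem_lpMeas_iff_aestronglyMeasurable]
  constructor
  · rintro ⟨f', hf', hff'⟩ g hg
    have h1 := (α.measurePreserving g⁻¹).quasiMeasurePreserving.ae_eq_comp hff'
    refine h1.trans (EventuallyEq.trans ?_ hff'.symm)
    -- Functions into `ℂ` agree almost everywhere once the preimages of each measurable set do,
    -- since countably many such sets separate points.
    refine Filter.EventuallyEq.of_forall_separating_preimage (MeasurableSet : Set ℂ → Prop) fun U hU => ?_
    exact ((α.measurableSet_invariantSigma_iff A).1 (hf'.measurable hU)).2 _ (inv_mem hg)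
  · intro h
    have hm : Measurable f := (Lp.stronglyMeasurable f).measurable
    have hmA : Measurable[α.invariantSigma A] f := by
      intro U hU
      refine (α.measurableSet_invariantSigma_iff A).2 ⟨hm hU, fun g hg => ?_⟩
      have := h g⁻¹ (inv_mem hg)
      rw [inv_inv] at this
      exact this.preimage U
    exact hmA.stronglyMeasurable.aestronglyMeasurable

theorem isDissociated [IsProbabilityMeasure μ] (hol : IsOligomorphic G)
    (hna : NoAlgebraicity G) (hwei : WeaklyEliminatesImaginaries G) (α : BooleanAction G μ) :
    α.IsDissociated := by
  intro A B hA hB f hf hf2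
  have _ : ∀ C, Fact (α.invariantSigma C ≤ ‹MeasurableSpace X›) := fun C =>
    ⟨α.invariantSigma_le C⟩
  have hproj : (lpMeas ℂ ℂ (α.invariantSigma A) 2 μ).starProjection ∘L
      (lpMeas ℂ ℂ (α.invariantSigma B) 2 μ).starProjection =
      (lpMeas ℂ ℂ (α.invariantSigma (A ∩ B)) 2 μ).starProjection := by
    refine starProjection_comp_eq_of_orthogonal ?_ ?_ ?_
    all_goals simp only [SetLike.le_def, mem_lpMeas_iff_koopman]
    · exact fun ξ hξ g hg => hξ g (fixingSubgroup_antitone G Ω Set.inter_subset_left hg)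
    · exact fun ξ hξ g hg => hξ g (fixingSubgroup_antitone G Ω Set.inter_subset_right hg)
    · exact fun ξ hξ hξ' η hη =>
        inner_eq_zero_of_invariant hol hna hwei α.koopman hA hB hξ hξ' hη
  have hfB : hf2.toLp f ∈ lpMeas ℂ ℂ (α.invariantSigma B) 2 μ :=
    (mem_lpMeas_iff_aestronglyMeasurable).2 ⟨f, hf.stronglyMeasurable, hf2.coeFn_toLp⟩
  have heq := congrArg (fun T => T (hf2.toLp f)) hproj
  simp only [ContinuousLinearMap.comp_apply, Submodule.starProjection_eq_self_iff.2 hfB] at heq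
  -- `condExpL2` is by definition the projection onto `lpMeas`, so `heq` already equates the two
  -- conditional expectations in `L²`.
  have hAe := hf2.condExpL2_ae_eq_condExp (𝕜 := ℂ) (α.invariantSigma_le A)
  have hDe := hf2.condExpL2_ae_eq_condExp (𝕜 := ℂ) (α.invariantSigma_le (A ∩ B))
  refine hAe.symm.trans (EventuallyEq.trans ?_ hDe)
  exact EventuallyEq.of_eq (congrArg (fun F : Lp ℂ 2 μ => (F : X → ℂ)) heq)

end BooleanAction

end PermGroup

theorem mainTheorem6 {Ω : Type u} [Countable Ω] [Infinite Ω]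
    (G : Subgroup (Equiv.Perm Ω)) (hG : IsClosed (G : Set (Equiv.Perm Ω)))
    (hol : PermGroup.IsOligomorphic G) (hna : PermGroup.NoAlgebraicity G)
    (hwei : PermGroup.WeaklyEliminatesImaginaries G) :
    PermGroup.IsDissociated.{u, v, w} G := by
  exact ⟨fun H _ _ _ π => π.isDissociated hol hna hwei,
    fun X _ _ μ _ α => α.isDissociated hol hna hwei⟩
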